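/- Let $k$ be an algebraically closed field of characteristic $p>0$, let $q=p^e$ with $e\ge 1$, and let $X\subset\mathbb P^3_k$ be a smooth extremal surface of degree $q+1$, that is, a smooth surface defined by a Frobenius form: a homogeneous polynomial of degree $q+1$ in the ideal $\langle x_1^q,x_2^q,x_3^q,x_4^q\rangle$ of $k[x_1,x_2,x_3,x_4]$. A quadric configuration on $X$ is a collection of $2(q+1)$ lines on $X$ consisting of two sets of $q+1$ pairwise skew lines such that each line in either set meets every line of the other set. Let $L_1,L_2,L_3$ be three pairwise skew lines on $X$. Then: 1. There is exactly one quadric configuration $\mathcal C$ on $X$ that contains $L_1$, $L_2$ and $L_3$. 2. There is exactly one smooth quadric surface $Q\subset\mathbb P^3_k$ that contains $L_1$, $L_2$ and $L_3$. The set of lines lying on both $X$ and $Q$ is $\mathcal C$; it has $2(q+1)$ elements, and as a set of points $X\cap Q$ is the union of these lines. The quadric $Q$ has exactly two rulings (families of pairwise skew lines on $Q$ that cover $Q$); each of them contains exactly $q+1$ of the lines of $\mathcal C$, every line of $\mathcal C$ lies in one of them, and each line of one ruling meets every line of the other. -/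

import Mathlib

open MvPolynomial
open scoped LinearAlgebra.Projectivization

/-- A Frobenius form with exponent `q`: a homogeneous polynomial of degree `q + 1` that lies in the
ideal generated by the `q`-th powers of the variables. -/
def IsFrobeniusForm {k σ : Type*} [CommRing k] (q : ℕ) (F : MvPolynomial σ k) : Prop :=
  F.IsHomogeneous (q + 1) ∧
    F ∈ Ideal.span (Set.range fun i : σ => (X i ^ q : MvPolynomial σ k))

/-- The Jacobian criterion for the projective hypersurface `F = 0` over an algebraically closed
field: no point of the hypersurface annihilates all partial derivatives of `F`.
The zero polynomial is not smooth in this sense. -/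
def IsSmoothForm {k σ : Type*} [Field k] (F : MvPolynomial σ k) : Prop :=
  ∀ v : σ → k, v ≠ 0 → eval v F = 0 → ∃ i, eval v (pderiv i F) ≠ 0

/-- The (closed) points of projective three space over `k`. -/
abbrev PThree (k : Type*) [Field k] : Type _ := ℙ k (Fin 4 → k)

/-- The points of projective three space at which `F` vanishes. It is used only for homogeneous
`F`, where the choice of homogeneous coordinates is irrelevant, see `mk_mem_projZeros`. -/
def projZeros {k : Type*} [Field k] (F : MvPolynomial (Fin 4) k) : Set (PThree k) :=
  {P | eval P.rep F = 0}

theorem mk_mem_projZeros {k : Type*} [Field k] {F : MvPolynomial (Fin 4) k} {d : ℕ}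
    (hF : F.IsHomogeneous d) (v : Fin 4 → k) (hv : v ≠ 0) :
    Projectivization.mk k v hv ∈ projZeros F ↔ eval v F = 0 := by
  obtain ⟨a, ha⟩ := Projectivization.exists_smul_eq_mk_rep k v hv
  have h : eval (Projectivization.mk k v hv).rep F = (a : k) ^ d * eval v F := by
    rw [← ha, Units.smul_def, eval_eq, eval_eq, Finset.mul_sum]
    refine Finset.sum_congr rfl fun n hn => ?_
    have hd : ∑ i ∈ n.support, n i = d := by
      have := hF (mem_support_iff.mp hn)
      simpa [Finsupp.weight_apply, Finsupp.sum] using this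
    simp only [Pi.smul_apply, smul_eq_mul, mul_pow, Finset.prod_mul_distrib,
      Finset.prod_pow_eq_pow_sum, hd]
    ring
  simp [projZeros, h]

/-- A line in projective three space: the projectivization of a two-dimensional vector subspace. -/
def IsLine {k : Type*} [Field k] (l : Projectivization.Subspace k (Fin 4 → k)) : Prop :=
  Module.finrank k l.submodule = 2

/-- The set of all lines contained in a set of points. -/
def linesOn {k : Type*} [Field k] (Z : Set (PThree k)) :
    Set (Projectivization.Subspace k (Fin 4 → k)) :=
  {l | IsLine l ∧ (l : Set (PThree k)) ⊆ Z}

/-- Two lines meet if they have a point in common. -/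
def Meet {k : Type*} [Field k] (l m : Projectivization.Subspace k (Fin 4 → k)) : Prop :=
  ((l : Set (PThree k)) ∩ m).Nonempty

/-- Two lines are skew if they have no point in common. -/
def Skew {k : Type*} [Field k] (l m : Projectivization.Subspace k (Fin 4 → k)) : Prop :=
  ¬ Meet l m

/-- A quadric configuration on a surface `Z` of degree `d`: a collection of `2d` lines on `Z`
consisting of two sets of `d` skew lines such that each line in either set meets every line
of the other set. -/
def IsQuadricConfiguration {k : Type*} [Field k] (Z : Set (PThree k)) (d : ℕ)
    (C : Set (Projectivization.Subspace k (Fin 4 → k))) : Prop :=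
  C ⊆ linesOn Z ∧ C.ncard = 2 * d ∧
    ∃ A B : Set (Projectivization.Subspace k (Fin 4 → k)),
      C = A ∪ B ∧ A.ncard = d ∧ B.ncard = d ∧ A.Pairwise Skew ∧ B.Pairwise Skew ∧
        ∀ l ∈ A, ∀ m ∈ B, Meet l m

/-- A smooth quadric surface in projective three space. -/
def IsSmoothQuadric {k : Type*} [Field k] (Q : Set (PThree k)) : Prop :=
  ∃ G : MvPolynomial (Fin 4) k, G.IsHomogeneous 2 ∧ IsSmoothForm G ∧ Q = projZeros G

/-- A ruling of a smooth quadric surface `Q`: a family of pairwise skew lines on `Q` such that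
every point of `Q` lies on a line of the family. -/
def IsRuling {k : Type*} [Field k] (Q : Set (PThree k))
    (R : Set (Projectivization.Subspace k (Fin 4 → k))) : Prop :=
  R ⊆ linesOn Q ∧ R.Pairwise Skew ∧ ∀ P ∈ Q, ∃ l ∈ R, P ∈ l

/-! Since `q` is a power of the characteristic, a Frobenius form is the diagonal `B v v` of a form
`B` that is `q`-semilinear in its first argument and linear in its second, and its partial
derivatives at `v` are the values of `B v` on the standard basis. If `B v v` vanishes on a subspace,
so does `B` (`sesq_eq_zero_of_diag_eq_zero`).

Three skew lines put coordinates on space: the vectors become 2 × 2 matrices, the points of the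
quadric are the rank one matrices `a sᵀ`, fixing `s` or `a` gives its two rulings, and the three
lines are `s = (1,0), (0,1), (1,1)` (`exists_eq_segreLine`). Vanishing of `B` on these lines forces
`F(a sᵀ) = m(a) * (s₀^q s₁ - s₁^q s₀)` with `m` a binary Frobenius form, nondegenerate because the
surface is smooth (`exists_isSplitForm`). Each factor is separable, so it has exactly `q + 1` zeros
on the projective line (`ncard_segreLine_zeros`). Hence the intersection with the quadric is `q + 1`
lines from each ruling.

For uniqueness, a line meeting three lines of one ruling lies in the other
(`mem_segreRuling_flipRows_of_meet`). This traps every quadric configuration through the three lines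
inside the quadric, and counting finishes. A quadratic form vanishing on the three lines is a
multiple of the determinant (`eq_segreQuadric`). -/

/-- A form of degree `q + 1` each of whose monomials is divisible by the `q`-th power of a variable
is a combination of the products `X i ^ q * X j`. -/
theorem exists_eq_sum_pow_mul {k σ : Type*} [CommRing k] [Fintype σ] {q : ℕ}
    {F : MvPolynomial σ k} (hF : F.IsHomogeneous (q + 1))
    (hq : ∀ m ∈ F.support, ∃ i, q ≤ m i) :
    ∃ A : σ → σ → k, F = ∑ i, ∑ j, C (A i j) * (X i ^ q * X j) := by
  classical
  rw [F.as_sum]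
  refine Finset.sum_induction _
    (fun G => ∃ A : σ → σ → k, G = ∑ i, ∑ j, C (A i j) * (X i ^ q * X j)) ?_ ?_ ?_
  · rintro _ _ ⟨A, rfl⟩ ⟨B, rfl⟩
    refine ⟨fun i j => A i j + B i j, ?_⟩
    simp only [map_add, add_mul, Finset.sum_add_distrib]
  · exact ⟨fun _ _ => 0, by simp⟩
  · intro m hm
    obtain ⟨i, hi⟩ := hq m hm
    have hdeg : m.degree = q + 1 := by
      rw [Finsupp.degree_eq_weight_one]
      exact hF (mem_support_iff.mp hm)
    obtain ⟨n, rfl⟩ : ∃ n, m = Finsupp.single i q + n :=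
      le_iff_exists_add.mp (Finsupp.single_le_iff.mpr hi)
    have hn : n.degree = 1 := by
      rw [map_add, Finsupp.degree_single] at hdeg
      omega
    obtain ⟨j, rfl⟩ := (Finsupp.sum_eq_one_iff n).mp hn
    refine ⟨fun i' j' => if i' = i ∧ j' = j then coeff (Finsupp.single i q + .single j 1) F else 0,
      ?_⟩
    rw [Finset.sum_eq_single i, Finset.sum_eq_single j]
    · simp only [and_self, if_true]
      rw [X_pow_eq_monomial, X, monomial_mul, C_mul_monomial]
      simp
    · intro b _ hb
      simp [hb]
    · simp
    · intro b _ hb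
      simp [hb]
    · simp

/-! ### Frobenius forms as diagonals of sesquilinear forms. -/

section SesqForm

variable {k ι : Type*} [Field k] [Fintype ι]

/-- The sesquilinear form with given coefficients on a standard vector space. -/
def sesqForm (τ : k →+* k) (A : ι → ι → k) : (ι → k) →ₛₗ[τ] (ι → k) →ₗ[k] k :=
  LinearMap.mk₂'ₛₗ τ (RingHom.id k) (fun u v => ∑ i, ∑ j, A i j * (τ (u i) * v j))
    (fun u u' v => by simp [add_mul, mul_add, Finset.sum_add_distrib])
    (fun c u v => by
      simp only [Pi.smul_apply, smul_eq_mul, map_mul, Finset.mul_sum]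
      refine Finset.sum_congr rfl fun i _ => Finset.sum_congr rfl fun j _ => ?_
      ring)
    (fun u v v' => by simp [mul_add, Finset.sum_add_distrib])
    (fun c u v => by
      simp only [Pi.smul_apply, smul_eq_mul, RingHom.id_apply, Finset.mul_sum]
      refine Finset.sum_congr rfl fun i _ => Finset.sum_congr rfl fun j _ => ?_
      ring)

theorem sesqForm_apply (τ : k →+* k) (A : ι → ι → k) (u v : ι → k) :
    sesqForm τ A u v = ∑ i, ∑ j, A i j * (τ (u i) * v j) := rfl

/-- A Frobenius form is the diagonal of a sesquilinear form, which also gives its partial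
derivatives. -/
theorem IsFrobeniusForm.exists_sesqForm {q : ℕ} {F : MvPolynomial ι k} (hF : IsFrobeniusForm q F)
    (hq : (q : k) = 0) (τ : k →+* k) (hτ : ∀ x, τ x = x ^ q) [DecidableEq ι] :
    ∃ B : (ι → k) →ₛₗ[τ] (ι → k) →ₗ[k] k, (∀ v, eval v F = B v v) ∧
      ∀ v j, eval v (pderiv j F) = B v (Pi.single j 1) := by
  obtain ⟨A, rfl⟩ : ∃ A : ι → ι → k, F = ∑ i, ∑ j, C (A i j) * (X i ^ q * X j) := by
    refine exists_eq_sum_pow_mul hF.1 fun m hm => ?_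
    have h : F ∈ Ideal.span ((fun s => monomial s (1 : k)) ''
        Set.range fun i : ι => Finsupp.single i q) := by
      rw [← Set.range_comp]
      simpa only [Function.comp_def, X_pow_eq_monomial] using hF.2
    obtain ⟨_, ⟨i, rfl⟩, hi⟩ := mem_ideal_span_monomial_image.mp h m hm
    exact ⟨i, Finsupp.single_le_iff.mp hi⟩
  refine ⟨sesqForm τ A, fun v => by simp [sesqForm_apply, hτ], fun v j => ?_⟩
  have hq' : (C (q : k) : MvPolynomial ι k) = 0 := by rw [hq, C_0]
  -- Only the linear factor of `X i ^ q * X l` contributes: the derivative of the `q`-th power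
  -- carries the factor `q = 0`.
  simp only [map_sum, Derivation.leibniz, pderiv_C, Derivation.leibniz_pow, smul_eq_mul,
    sesqForm_apply, hτ, pderiv_X, Pi.single_apply]
  refine Finset.sum_congr rfl fun i _ => Finset.sum_congr rfl fun l _ => ?_
  simp only [map_add, map_mul, map_pow, eval_C, eval_X, nsmul_eq_mul, map_natCast, hq,
    mul_zero, zero_mul, add_zero]
  split_ifs <;> simp

/-- A form of degree two is the diagonal of a bilinear form. -/
theorem MvPolynomial.IsHomogeneous.exists_bilinForm {G : MvPolynomial ι k}
    (hG : G.IsHomogeneous 2) :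
    ∃ B : (ι → k) →ₗ[k] (ι → k) →ₗ[k] k, ∀ v, eval v G = B v v := by
  obtain ⟨A, rfl⟩ : ∃ A : ι → ι → k, G = ∑ i, ∑ j, C (A i j) * (X i ^ 1 * X j) := by
    refine exists_eq_sum_pow_mul hG fun m hm => ?_
    by_contra! h
    have hdeg : m.degree = 2 := by
      rw [Finsupp.degree_eq_weight_one]
      exact hG (mem_support_iff.mp hm)
    have : m = 0 := Finsupp.ext fun i => by simpa using h i
    simp [this] at hdeg
  exact ⟨sesqForm (RingHom.id k) A, fun v => by simp [sesqForm_apply]⟩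

end SesqForm

/-- A sesquilinear form over an infinite field, for a proper power map, vanishes on a subspace
if its diagonal does. -/
theorem sesq_eq_zero_of_diag_eq_zero {k V : Type*} [Field k] [Infinite k] [AddCommGroup V]
    [Module k V] {q : ℕ} (hq : 2 ≤ q) {τ : k →+* k} (hτ : ∀ x, τ x = x ^ q)
    (B : V →ₛₗ[τ] V →ₗ[k] k) (W : Submodule k V) (hW : ∀ v ∈ W, B v v = 0)
    {u v : V} (hu : u ∈ W) (hv : v ∈ W) : B u v = 0 := by
  -- Expand the diagonal at `u + t v`: the terms `t^q B v u` and `t B u v` remain, and `q ≠ 1`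
  -- separates them.
  have h : Polynomial.C (B v u) * Polynomial.X ^ q + Polynomial.C (B u v) * Polynomial.X = 0 := by
    refine Polynomial.funext fun t => ?_
    have := hW (u + t • v) (W.add_mem hu (W.smul_mem t hv))
    simp only [map_add, LinearMap.add_apply, LinearMap.map_smulₛₗ, LinearMap.smul_apply,
      RingHom.id_apply, smul_eq_mul, hτ, hW u hu, hW v hv] at this
    simp only [Polynomial.eval_add, Polynomial.eval_mul, Polynomial.eval_C, Polynomial.eval_pow,
      Polynomial.eval_X, Polynomial.eval_zero]
    linear_combination this
  have h1 := congrArg (fun f => Polynomial.coeff f 1) h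
  simpa [Polynomial.coeff_X_pow, show (1 : ℕ) ≠ q by omega] using h1

/-! ### The quadric of rank one matrices, its lines and its rulings. -/

section Rulings

open Matrix

variable {k : Type*} [Field k]

/-- A determinant zero matrix of size two is a product of a column and a nonzero row. -/
theorem Matrix.exists_eq_vecMulVec {A : Matrix (Fin 2) (Fin 2) k} (hA : A.det = 0) :
    ∃ a s : Fin 2 → k, s ≠ 0 ∧ A = vecMulVec a s := by
  rw [det_fin_two] at hA
  by_cases h0 : A 0 = 0
  · by_cases h1 : A 1 = 0
    · refine ⟨0, ![1, 0], by simp, ?_⟩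
      ext i j
      fin_cases i <;> simp [vecMulVec_apply, h0, h1]
    · refine ⟨![0, 1], A 1, h1, ?_⟩
      ext i j
      fin_cases i <;> simp [vecMulVec_apply, h0]
  · have : ∃ c : k, A 1 = c • A 0 := by
      by_cases h00 : A 0 0 = 0
      · have h01 : A 0 1 ≠ 0 := fun h01 => h0 (by ext j; fin_cases j <;> simp [h00, h01])
        refine ⟨A 1 1 / A 0 1, ?_⟩
        have h10 : A 1 0 = 0 := by simpa [h00, h01] using hA
        ext j
        fin_cases j
        · simp [h00, h10]
        · simp [div_mul_cancel₀ _ h01]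
      · refine ⟨A 1 0 / A 0 0, ?_⟩
        ext j
        fin_cases j
        · simp [div_mul_cancel₀ _ h00]
        · simp only [Fin.mk_one, Fin.isValue, Pi.smul_apply, smul_eq_mul]
          field_simp
          linear_combination hA
    obtain ⟨c, hc⟩ := this
    refine ⟨![1, c], A 0, h0, ?_⟩
    ext i j
    fin_cases i <;> simp [vecMulVec_apply, hc]

/-- Two plane vectors with vanishing determinant are proportional. -/
theorem exists_eq_smul_of_cross_eq_zero {s t : Fin 2 → k} (hs : s ≠ 0)
    (h : s 0 * t 1 - s 1 * t 0 = 0) : ∃ c : k, t = c • s := by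
  by_cases h0 : s 0 = 0
  · have h1 : s 1 ≠ 0 := fun h1 => hs (by ext j; fin_cases j <;> simp [h0, h1])
    have ht : t 0 = 0 := by simpa [h0, h1] using h
    refine ⟨t 1 / s 1, ?_⟩
    ext j
    fin_cases j
    · simp [h0, ht]
    · simp [div_mul_cancel₀ _ h1]
  · refine ⟨t 0 / s 0, ?_⟩
    ext j
    fin_cases j
    · simp [div_mul_cancel₀ _ h0]
    · simp only [Fin.mk_one, Fin.isValue, Pi.smul_apply, smul_eq_mul]
      field_simp
      linear_combination h

variable (Ψ : Matrix (Fin 2) (Fin 2) k ≃ₗ[k] (Fin 4 → k))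

/-- The linear map sending a column `a` to the image of its product with the row `s`. -/
def segre (s : Fin 2 → k) : (Fin 2 → k) →ₗ[k] (Fin 4 → k) where
  toFun a := Ψ (vecMulVec a s)
  map_add' a b := by rw [add_vecMulVec, map_add]
  map_smul' c a := by rw [smul_vecMulVec, map_smul, RingHom.id_apply]

/-- The line of all products of columns with a fixed row. -/
def segreLine (s : Fin 2 → k) : Projectivization.Subspace k (Fin 4 → k) :=
  (LinearMap.range (segre Ψ s)).projectivization

/-- The family of all lines given by a fixed row. -/
def segreRuling : Set (Projectivization.Subspace k (Fin 4 → k)) :=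
  {L | ∃ s ≠ 0, L = segreLine Ψ s}

/-- The quadric of points that correspond to matrices of determinant zero. -/
def segreQuadric : Set (PThree k) := {P | (Ψ.symm P.rep).det = 0}

/-- The same parametrization with rows and columns exchanged. -/
abbrev flipRows : Matrix (Fin 2) (Fin 2) k ≃ₗ[k] (Fin 4 → k) :=
  (transposeLinearEquiv (Fin 2) (Fin 2) k k).trans Ψ

theorem segre_apply (s a : Fin 2 → k) : segre Ψ s a = Ψ (vecMulVec a s) := rfl

theorem flipRows_flipRows : flipRows (flipRows Ψ) = Ψ := by
  ext A
  simp

theorem segre_flipRows (s a : Fin 2 → k) : segre (flipRows Ψ) s a = segre Ψ a s := by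
  simp [segre_apply, transpose_vecMulVec]

theorem segreQuadric_flipRows : segreQuadric (flipRows Ψ) = segreQuadric Ψ := by
  ext P
  simp [segreQuadric]

theorem mk_mem_segreLine {s : Fin 2 → k} {v : Fin 4 → k} (hv : v ≠ 0) :
    Projectivization.mk k v hv ∈ segreLine Ψ s ↔ ∃ a, segre Ψ s a = v := by
  rw [segreLine, Submodule.mk_mem_projectivization_iff]
  rfl

theorem mk_mem_segreQuadric {v : Fin 4 → k} (hv : v ≠ 0) :
    Projectivization.mk k v hv ∈ segreQuadric Ψ ↔ (Ψ.symm v).det = 0 := by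
  obtain ⟨a, ha⟩ := Projectivization.exists_smul_eq_mk_rep k v hv
  simp only [segreQuadric, Set.mem_ofPred_eq, ← ha, Units.smul_def, map_smul, det_smul]
  simp

theorem segre_ne_zero {s a : Fin 2 → k} (hs : s ≠ 0) (ha : a ≠ 0) : segre Ψ s a ≠ 0 := by
  rw [segre_apply, Ne, map_eq_zero_iff _ Ψ.injective, vecMulVec_eq_zero]
  tauto

theorem det_symm_segre (s a : Fin 2 → k) : (Ψ.symm (segre Ψ s a)).det = 0 := by
  simp [segre_apply, det_vecMulVec]

theorem segreLine_smul {c : k} (hc : c ≠ 0) (s : Fin 2 → k) :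
    segreLine Ψ (c • s) = segreLine Ψ s := by
  rw [segreLine, segreLine]
  congr 1
  have h : segre Ψ (c • s) = c • segre Ψ s := by
    refine LinearMap.ext fun a => ?_
    simp [segre_apply, vecMulVec_smul]
  rw [h, LinearMap.range_smul _ _ hc]

theorem isLine_segreLine {s : Fin 2 → k} (hs : s ≠ 0) : IsLine (segreLine Ψ s) := by
  have h : Function.Injective (segre Ψ s) := by
    rw [← LinearMap.ker_eq_bot, LinearMap.ker_eq_bot']
    intro a ha
    by_contra h
    exact segre_ne_zero Ψ hs h ha
  rw [IsLine, segreLine, Submodule.projectivization, OrderIso.apply_symm_apply,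
    LinearMap.finrank_range_of_inj h]
  simp

theorem mk_segre_mem {s a : Fin 2 → k} (h : segre Ψ s a ≠ 0) :
    Projectivization.mk k (segre Ψ s a) h ∈ segreLine Ψ s :=
  (mk_mem_segreLine Ψ h).mpr ⟨a, rfl⟩

/-- A nonzero rank one matrix determines its row factor up to a scalar; the vanishing cross
determinant expresses this proportionality. -/
theorem cross_eq_zero_of_segre_eq {s t a b : Fin 2 → k} (h : segre Ψ s a = segre Ψ t b)
    (h0 : segre Ψ s a ≠ 0) : s 0 * t 1 - s 1 * t 0 = 0 := by
  have hA := Ψ.injective h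
  have ha : a ≠ 0 := by
    rintro rfl
    simp at h0
  have e (i j : Fin 2) : a i * s j = b i * t j := by
    simpa [vecMulVec_apply] using congrFun (congrFun hA i) j
  obtain ⟨i, hi⟩ := Function.ne_iff.mp ha
  refine mul_left_cancel₀ hi ?_
  linear_combination t 1 * e i 0 - t 0 * e i 1

theorem segreLine_eq_of_meet {s t : Fin 2 → k} (hs : s ≠ 0) (ht : t ≠ 0)
    (h : Meet (segreLine Ψ s) (segreLine Ψ t)) : segreLine Ψ s = segreLine Ψ t := by
  obtain ⟨P, hP, hP'⟩ := h
  induction P using Projectivization.ind with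
  | h v hv =>
    obtain ⟨a, rfl⟩ := (mk_mem_segreLine Ψ hv).mp hP
    obtain ⟨b, hb⟩ := (mk_mem_segreLine Ψ hv).mp hP'
    obtain ⟨c, rfl⟩ := exists_eq_smul_of_cross_eq_zero hs (cross_eq_zero_of_segre_eq Ψ hb.symm hv)
    refine (segreLine_smul Ψ ?_ s).symm
    rintro rfl
    simp at ht

theorem pairwise_skew_segreRuling : (segreRuling Ψ).Pairwise Skew := by
  rintro _ ⟨s, hs, rfl⟩ _ ⟨t, ht, rfl⟩ hne h
  exact hne (segreLine_eq_of_meet Ψ hs ht h)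

theorem meet_of_mem_segreRuling {L M : Projectivization.Subspace k (Fin 4 → k)}
    (hL : L ∈ segreRuling Ψ) (hM : M ∈ segreRuling (flipRows Ψ)) : Meet L M := by
  obtain ⟨s, hs, rfl⟩ := hL
  obtain ⟨a, ha, rfl⟩ := hM
  have h := segre_ne_zero Ψ hs ha
  refine ⟨Projectivization.mk k _ h, mk_segre_mem Ψ h, ?_⟩
  exact (mk_mem_segreLine _ h).mpr ⟨s, segre_flipRows Ψ a s⟩

theorem segreRuling_subset : segreRuling Ψ ⊆ linesOn (segreQuadric Ψ) := by
  rintro _ ⟨s, hs, rfl⟩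
  refine ⟨isLine_segreLine Ψ hs, fun P hP => ?_⟩
  induction P using Projectivization.ind with
  | h v hv =>
    obtain ⟨a, rfl⟩ := (mk_mem_segreLine Ψ hv).mp hP
    exact (mk_mem_segreQuadric Ψ hv).mpr (det_symm_segre Ψ s a)

theorem exists_eq_segre {v : Fin 4 → k} (hv : (Ψ.symm v).det = 0) :
    ∃ s a, s ≠ 0 ∧ segre Ψ s a = v := by
  obtain ⟨a, s, hs, h⟩ := Matrix.exists_eq_vecMulVec hv
  exact ⟨s, a, hs, by rw [segre_apply, ← h, LinearEquiv.apply_symm_apply]⟩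

theorem exists_mem_segreRuling {P : PThree k} (hP : P ∈ segreQuadric Ψ) :
    ∃ L ∈ segreRuling Ψ, P ∈ L := by
  induction P using Projectivization.ind with
  | h v hv =>
    obtain ⟨s, a, hs, rfl⟩ := exists_eq_segre Ψ ((mk_mem_segreQuadric Ψ hv).mp hP)
    exact ⟨_, ⟨s, hs, rfl⟩, mk_segre_mem Ψ hv⟩

theorem isRuling_segreRuling : IsRuling (segreQuadric Ψ) (segreRuling Ψ) :=
  ⟨segreRuling_subset Ψ, pairwise_skew_segreRuling Ψ, fun _ => exists_mem_segreRuling Ψ⟩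

theorem isRuling_segreRuling_flipRows : IsRuling (segreQuadric Ψ) (segreRuling (flipRows Ψ)) := by
  simpa only [segreQuadric_flipRows] using isRuling_segreRuling (flipRows Ψ)

/-- A common line would meet every line of the first ruling, hence equal each of them by skewness;
but `![1, 0]` and `![0, 1]` give different lines. -/
theorem disjoint_segreRuling : Disjoint (segreRuling Ψ) (segreRuling (flipRows Ψ)) := by
  rw [Set.disjoint_left]
  intro L hL hL'
  have key (M) (hM : M ∈ segreRuling Ψ) : M = L := by
    by_contra hne
    exact pairwise_skew_segreRuling Ψ hM hL hne (meet_of_mem_segreRuling Ψ hM hL')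
  have h0 : (![1, 0] : Fin 2 → k) ≠ 0 := by simp
  have h1 : (![0, 1] : Fin 2 → k) ≠ 0 := by simp
  have h := (key _ ⟨_, h0, rfl⟩).trans (key _ ⟨_, h1, rfl⟩).symm
  have hz := segre_ne_zero Ψ h0 h0
  have hm := mk_segre_mem Ψ hz
  rw [h, mk_mem_segreLine] at hm
  obtain ⟨b, hb⟩ := hm
  simpa using cross_eq_zero_of_segre_eq Ψ hb.symm hz

theorem IsLine.submodule_eq_span {L : Projectivization.Subspace k (Fin 4 → k)} (hL : IsLine L)
    {u v : Fin 4 → k} (hu : u ∈ L.submodule) (hv : v ∈ L.submodule)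
    (huv : LinearIndependent k ![u, v]) : L.submodule = Submodule.span k {u, v} := by
  symm
  refine Submodule.eq_of_le_of_finrank_eq ?_ ?_
  · rw [Submodule.span_le]
    rintro x (rfl | rfl)
    exacts [hu, hv]
  · have := finrank_span_eq_card huv
    rw [show Module.finrank k L.submodule = 2 from hL]
    rwa [Matrix.range_cons_cons_empty, Fintype.card_fin] at this

/-- A line that passes through the points of two independent elements of determinant zero and
through a third point of the quadric belongs to one of the two rulings. -/
theorem mem_segreRuling_or_of_add {L : Projectivization.Subspace k (Fin 4 → k)} (hL : IsLine L)
    {u v : Fin 4 → k} (hu : u ∈ L.submodule) (hv : v ∈ L.submodule)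
    (huv : LinearIndependent k ![u, v]) (hu0 : (Ψ.symm u).det = 0) (hv0 : (Ψ.symm v).det = 0)
    (hadd : (Ψ.symm (u + v)).det = 0) :
    L ∈ segreRuling Ψ ∪ segreRuling (flipRows Ψ) := by
  have hspan := hL.submodule_eq_span hu hv huv
  have hfin {Φ : Matrix (Fin 2) (Fin 2) k ≃ₗ[k] (Fin 4 → k)} {s a b : Fin 2 → k} (hs : s ≠ 0)
      (ha : segre Φ s a = u) (hb : segre Φ s b = v) : L ∈ segreRuling Φ := by
    refine ⟨s, hs, ?_⟩
    apply Projectivization.Subspace.submodule.injective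
    have hl : Module.finrank k (segreLine Φ s).submodule = 2 := isLine_segreLine Φ hs
    refine Submodule.eq_of_le_of_finrank_eq ?_ (hL.trans hl.symm)
    rw [hspan, Submodule.span_le, segreLine, Submodule.projectivization, OrderIso.apply_symm_apply]
    rintro x (rfl | rfl)
    exacts [⟨a, ha⟩, ⟨b, hb⟩]
  obtain ⟨s, a, hs, rfl⟩ := exists_eq_segre Ψ hu0
  obtain ⟨t, b, ht, rfl⟩ := exists_eq_segre Ψ hv0
  have ha : a ≠ 0 := by
    rintro rfl
    simpa using huv.ne_zero 0
  rw [segre_apply, segre_apply, ← map_add, LinearEquiv.symm_apply_apply, det_fin_two] at hadd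
  simp only [Matrix.add_apply, vecMulVec_apply] at hadd
  -- The determinant of `a sᵀ + b tᵀ` factors. If the rows are proportional the line is in the first
  -- ruling, if the columns are, in the second.
  have hprod : (s 0 * t 1 - s 1 * t 0) * (a 0 * b 1 - a 1 * b 0) = 0 := by
    linear_combination hadd
  rcases mul_eq_zero.mp hprod with h | h
  · obtain ⟨c, rfl⟩ := exists_eq_smul_of_cross_eq_zero hs h
    refine Or.inl (hfin hs rfl (b := c • b) ?_)
    simp [segre_apply, vecMulVec_smul]
  · obtain ⟨c, rfl⟩ := exists_eq_smul_of_cross_eq_zero ha h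
    refine Or.inr (hfin ha (segre_flipRows Ψ a s) (b := c • t) ?_)
    rw [segre_flipRows]
    simp [segre_apply, vecMulVec_smul]

theorem linesOn_segreQuadric :
    linesOn (segreQuadric Ψ) = segreRuling Ψ ∪ segreRuling (flipRows Ψ) := by
  refine Set.Subset.antisymm ?_ (Set.union_subset (segreRuling_subset Ψ)
    (isRuling_segreRuling_flipRows Ψ).1)
  rintro L ⟨hL, hLQ⟩
  have hdet (v) (hv : v ∈ L.submodule) : (Ψ.symm v).det = 0 := by
    by_cases h0 : v = 0
    · simp [h0]
    · exact (mk_mem_segreQuadric Ψ h0).mp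
        (hLQ ((Projectivization.Subspace.mem_submodule_iff L h0).mp hv))
  have b := Module.finBasisOfFinrankEq k L.submodule hL
  refine mem_segreRuling_or_of_add Ψ hL (b 0).2 (b 1).2 ?_ (hdet _ (b 0).2) (hdet _ (b 1).2)
    (hdet _ (b 0 + b 1).2)
  have e : ![(b 0 : Fin 4 → k), (b 1 : Fin 4 → k)] = L.submodule.subtype ∘ b := by
    ext i
    fin_cases i <;> rfl
  rw [e]
  exact b.linearIndependent.map' L.submodule.subtype (by simp)

/-- A line meeting three lines of a ruling belongs to the opposite ruling. -/
theorem mem_segreRuling_flipRows_of_meet {L M₁ M₂ M₃ : Projectivization.Subspace k (Fin 4 → k)}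
    (hL : IsLine L) (h₁ : M₁ ∈ segreRuling Ψ) (h₂ : M₂ ∈ segreRuling Ψ)
    (h₃ : M₃ ∈ segreRuling Ψ) (h₁₂ : M₁ ≠ M₂) (h₁₃ : M₁ ≠ M₃) (h₂₃ : M₂ ≠ M₃)
    (hm₁ : Meet L M₁) (hm₂ : Meet L M₂) (hm₃ : Meet L M₃) :
    L ∈ segreRuling (flipRows Ψ) := by
  -- A member of the ruling cannot meet two different members, except by being one of them, and even
  -- then it misses the other.
  have hnot : L ∉ segreRuling Ψ := fun hLΨ => by
    by_cases h : L = M₁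
    · exact pairwise_skew_segreRuling Ψ hLΨ h₂ (h ▸ h₁₂) hm₂
    · exact pairwise_skew_segreRuling Ψ hLΨ h₁ h hm₁
  suffices h : L ∈ segreRuling Ψ ∪ segreRuling (flipRows Ψ) from h.resolve_left hnot
  have pt {M} (hM : M ∈ segreRuling Ψ) (hm : Meet L M) :
      ∃ v : Fin 4 → k, v ≠ 0 ∧ v ∈ L.submodule ∧ v ∈ M.submodule ∧ (Ψ.symm v).det = 0 := by
    obtain ⟨P, hPL, hPM⟩ := hm
    have hPQ := (segreRuling_subset Ψ hM).2 hPM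
    induction P using Projectivization.ind with
    | h v hv =>
      exact ⟨v, hv, (Projectivization.Subspace.mem_submodule_iff L hv).mpr hPL,
        (Projectivization.Subspace.mem_submodule_iff M hv).mpr hPM,
        (mk_mem_segreQuadric Ψ hv).mp hPQ⟩
  have skew {M N} (hM : M ∈ segreRuling Ψ) (hN : N ∈ segreRuling Ψ) (hMN : M ≠ N) {v : Fin 4 → k}
      (hvM : v ∈ M.submodule) (hvN : v ∈ N.submodule) : v = 0 := by
    by_contra hv
    exact pairwise_skew_segreRuling Ψ hM hN hMN ⟨Projectivization.mk k v hv,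
      (Projectivization.Subspace.mem_submodule_iff M hv).mp hvM,
      (Projectivization.Subspace.mem_submodule_iff N hv).mp hvN⟩
  obtain ⟨u, hu0, huL, huM, hud⟩ := pt h₁ hm₁
  obtain ⟨v, hv0, hvL, hvM, hvd⟩ := pt h₂ hm₂
  obtain ⟨w, hw0, hwL, hwM, hwd⟩ := pt h₃ hm₃
  have hind : LinearIndependent k ![u, v] := by
    rw [LinearIndependent.pair_iff' hu0]
    intro c hc
    exact hv0 (skew h₁ h₂ h₁₂ (hc ▸ Submodule.smul_mem _ c huM) hvM)
  rw [hL.submodule_eq_span huL hvL hind] at hwL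
  obtain ⟨α, β, rfl⟩ := Submodule.mem_span_pair.mp hwL
  have hα : α ≠ 0 := by
    rintro rfl
    refine hw0 (skew h₂ h₃ h₂₃ ?_ hwM)
    simpa using Submodule.smul_mem _ β hvM
  have hβ : β ≠ 0 := by
    rintro rfl
    refine hw0 (skew h₁ h₃ h₁₃ ?_ hwM)
    simpa using Submodule.smul_mem _ α huM
  -- Both coefficients of the third point are nonzero, so rescaling the first two points makes the
  -- third their sum.
  refine mem_segreRuling_or_of_add Ψ hL (Submodule.smul_mem _ α huL) (Submodule.smul_mem _ β hvL)
    ?_ (by simp [hud]) (by simp [hvd]) hwd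
  rw [LinearIndependent.pair_iff] at hind ⊢
  intro x y hxy
  simpa [hα, hβ] using hind (x * α) (y * β) (by simpa [mul_smul] using hxy)

/-- Lines from opposite families meet, so a skew family stays within one of them. A line of that
family left out could not have its points covered, since other members of the family miss it. -/
theorem isRuling_segreQuadric_iff (T : Set (Projectivization.Subspace k (Fin 4 → k))) :
    IsRuling (segreQuadric Ψ) T ↔ T = segreRuling Ψ ∨ T = segreRuling (flipRows Ψ) := by
  refine ⟨?_, ?_⟩
  · rintro ⟨hTQ, hT, hcov⟩
    rw [linesOn_segreQuadric] at hTQ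
    have key {Φ : Matrix (Fin 2) (Fin 2) k ≃ₗ[k] (Fin 4 → k)}
        (hTQ : T ⊆ segreRuling Φ ∪ segreRuling (flipRows Φ))
        (hcov : ∀ P ∈ segreQuadric Φ, ∃ l ∈ T, P ∈ l)
        {L} (hL : L ∈ T) (hLΦ : L ∈ segreRuling Φ) : T = segreRuling Φ := by
      have hsub : T ⊆ segreRuling Φ := fun M hM => by
        refine (hTQ hM).resolve_right fun hM' => ?_
        exact hT hL hM ((disjoint_segreRuling Φ).ne_of_mem hLΦ hM')
          (meet_of_mem_segreRuling Φ hLΦ hM')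
      refine hsub.antisymm ?_
      rintro _ ⟨s, hs, rfl⟩
      have hz := segre_ne_zero Φ hs hs
      have hP := mk_segre_mem Φ hz
      obtain ⟨M, hM, hPM⟩ := hcov _ ((segreRuling_subset Φ ⟨s, hs, rfl⟩).2 hP)
      have : segreLine Φ s = M := by
        by_contra hne
        exact pairwise_skew_segreRuling Φ ⟨s, hs, rfl⟩ (hsub hM) hne ⟨_, hP, hPM⟩
      rwa [this]
    have h0 : (![1, 0] : Fin 2 → k) ≠ 0 := by simp
    have hz := segre_ne_zero Ψ h0 h0
    obtain ⟨L, hL, -⟩ := hcov (Projectivization.mk k _ hz)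
      ((mk_mem_segreQuadric Ψ hz).mpr (det_symm_segre Ψ _ _))
    rcases hTQ hL with hLΨ | hLΨ
    · exact Or.inl (key hTQ hcov hL hLΨ)
    · refine Or.inr (key ?_ ?_ hL hLΨ)
      · rwa [flipRows_flipRows, Set.union_comm]
      · rwa [segreQuadric_flipRows]
  · rintro (rfl | rfl)
    exacts [isRuling_segreRuling Ψ, isRuling_segreRuling_flipRows Ψ]

end Rulings

/-! ### Zeros of nondegenerate binary Frobenius forms. -/

section Counting

open Matrix

variable {k : Type*} [Field k]

/-- The binary Frobenius form with given coefficients. -/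
def binaryForm (q : ℕ) (m : Matrix (Fin 2) (Fin 2) k) (s : Fin 2 → k) : k :=
  ∑ i, ∑ j, m i j * (s i ^ q * s j)

theorem binaryForm_smul (q : ℕ) (m : Matrix (Fin 2) (Fin 2) k) (c : k) (s : Fin 2 → k) :
    binaryForm q m (c • s) = c ^ (q + 1) * binaryForm q m s := by
  simp only [binaryForm, Fin.sum_univ_two, Pi.smul_apply, smul_eq_mul]
  ring

/-- The dehomogenization of a binary Frobenius form. -/
noncomputable def affineForm (q : ℕ) (m : Matrix (Fin 2) (Fin 2) k) : Polynomial k :=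
  .C (m 0 0) * .X ^ (q + 1) + .C (m 0 1) * .X ^ q + .C (m 1 0) * .X + .C (m 1 1)

theorem eval_affineForm (q : ℕ) (m : Matrix (Fin 2) (Fin 2) k) (x : k) :
    (affineForm q m).eval x = binaryForm q m ![x, 1] := by
  simp [affineForm, binaryForm]
  ring

/-- As `q = 0` in `k`, the derivative is `m₀₀ x^q + m₁₀`. At a common root `x` of `f` and `f'`, both
`f'` and `f - x f' = m₀₁ x^q + m₁₁` vanish, so the row `(x^q, 1)` is killed by `m`. -/
theorem separable_affineForm [IsAlgClosed k] {q : ℕ} (hq : (q : k) = 0)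
    {m : Matrix (Fin 2) (Fin 2) k} (hm : m.det ≠ 0) : (affineForm q m).Separable := by
  rw [Polynomial.Separable, Polynomial.isCoprime_iff_aeval_ne_zero_of_isAlgClosed k k]
  intro x
  by_contra! h
  obtain ⟨h1, h2⟩ := h
  simp only [affineForm, Polynomial.aeval_def, Polynomial.eval₂_eq_eval_map, Polynomial.map_id,
    Algebra.algebraMap_self, Polynomial.eval_add, Polynomial.eval_mul, Polynomial.eval_C,
    Polynomial.eval_pow, Polynomial.eval_X, Polynomial.derivative_add, Polynomial.derivative_mul,
    Polynomial.derivative_C, Polynomial.derivative_X_pow, Polynomial.derivative_X, hq,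
    Nat.cast_add, Nat.cast_one, Nat.add_sub_cancel] at h1 h2
  simp only [zero_mul, mul_zero, zero_add, add_zero, one_mul,
    mul_one, Polynomial.eval_one, Polynomial.eval_zero] at h2
  have h3 : m 0 1 * x ^ q + m 1 1 = 0 := by linear_combination h1 - x * h2
  apply hm
  rw [det_fin_two]
  linear_combination m 0 0 * h3 - m 0 1 * h2

theorem natDegree_affineForm_of_ne {q : ℕ} (hq : 1 ≤ q) {m : Matrix (Fin 2) (Fin 2) k}
    (h : m 0 0 ≠ 0) : (affineForm q m).natDegree = q + 1 := by
  refine Polynomial.natDegree_eq_of_le_of_coeff_ne_zero ?_ ?_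
  · rw [affineForm]
    compute_degree
  · simpa [affineForm, Polynomial.coeff_X, Polynomial.coeff_C, Polynomial.coeff_X_pow,
      show ¬ q = 0 by omega] using h

/-- Here `(1 : 0)` is a zero at infinity, which replaces the lost root. With `q = 1` the terms in `X
^ q` and `X` would merge. -/
theorem natDegree_affineForm_of_eq {q : ℕ} (hq : 2 ≤ q) {m : Matrix (Fin 2) (Fin 2) k}
    (hm : m.det ≠ 0) (h : m 0 0 = 0) : (affineForm q m).natDegree = q := by
  have h01 : m 0 1 ≠ 0 := fun h01 => hm (by simp [det_fin_two, h, h01])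
  refine Polynomial.natDegree_eq_of_le_of_coeff_ne_zero ?_ ?_
  · rw [affineForm, h, Polynomial.C_0, zero_mul, zero_add]
    compute_degree
    omega
  · simpa [affineForm, h, Polynomial.coeff_X, Polynomial.coeff_C, Polynomial.coeff_X_pow,
      show ¬ q = 0 by omega, show ¬ 1 = q by omega] using h01

theorem cross_eq_zero_of_segreLine_eq (Ψ : Matrix (Fin 2) (Fin 2) k ≃ₗ[k] (Fin 4 → k))
    {s t : Fin 2 → k} (hs : s ≠ 0) (h : segreLine Ψ s = segreLine Ψ t) :
    s 0 * t 1 - s 1 * t 0 = 0 := by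
  have hz := segre_ne_zero Ψ hs hs
  have hm := mk_segre_mem Ψ hz
  rw [h, mk_mem_segreLine] at hm
  obtain ⟨b, hb⟩ := hm
  exact cross_eq_zero_of_segre_eq Ψ hb.symm hz

/-- A nondegenerate binary Frobenius form has `q + 1` zeros on the projective line. -/
theorem ncard_segreLine_zeros [IsAlgClosed k] (Ψ : Matrix (Fin 2) (Fin 2) k ≃ₗ[k] (Fin 4 → k))
    {q : ℕ} (hq2 : 2 ≤ q) (hq : (q : k) = 0) {m : Matrix (Fin 2) (Fin 2) k} (hm : m.det ≠ 0) :
    {L | ∃ s ≠ 0, binaryForm q m s = 0 ∧ L = segreLine Ψ s}.ncard = q + 1 := by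
  classical
  set f := affineForm q m with hf
  have hsep : f.Separable := separable_affineForm hq hm
  have hinf : binaryForm q m ![1, 0] = m 0 0 := by
    simp [binaryForm, show q ≠ 0 by omega]
  have hne : (![1, 0] : Fin 2 → k) ≠ 0 := by simp
  have hne' (x : k) : (![x, 1] : Fin 2 → k) ≠ 0 := by simp
  have hroots : (f.rootSet k).ncard = f.natDegree := by
    rw [← Polynomial.card_rootSet_eq_natDegree hsep (IsAlgClosed.splits (f.map (algebraMap k k))),
      ← Nat.card_coe_set_eq, Nat.card_eq_fintype_card]
  have hmem (x : k) : x ∈ f.rootSet k ↔ binaryForm q m ![x, 1] = 0 := by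
    rw [Polynomial.mem_rootSet_of_ne hsep.ne_zero, ← eval_affineForm]
    simp [hf]
  have hinj : Function.Injective fun x : k => segreLine Ψ ![x, 1] := fun x y h => by
    simpa [sub_eq_zero] using cross_eq_zero_of_segreLine_eq Ψ (hne' x) h
  have himg : ((fun x : k => segreLine Ψ ![x, 1]) '' f.rootSet k).ncard = f.natDegree := by
    rw [Set.ncard_image_of_injective _ hinj, hroots]
  have hcase (s : Fin 2 → k) (hs : s ≠ 0) (hs0 : binaryForm q m s = 0) :
      segreLine Ψ s ∈ (fun x : k => segreLine Ψ ![x, 1]) '' f.rootSet k ∨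
        (m 0 0 = 0 ∧ segreLine Ψ s = segreLine Ψ ![1, 0]) := by
    by_cases h1 : s 1 = 0
    · have h0 : s 0 ≠ 0 := fun h0 => hs (by ext j; fin_cases j <;> simp [h0, h1])
      have e : s = s 0 • ![1, 0] := by ext j; fin_cases j <;> simp [h1]
      rw [e, binaryForm_smul, hinf] at hs0
      refine Or.inr ⟨by simpa [h0] using hs0, ?_⟩
      rw [e, segreLine_smul Ψ h0]
    · have e : s = s 1 • ![s 0 / s 1, 1] := by
        ext j; fin_cases j <;> simp [mul_div_cancel₀ _ h1]
      rw [e, binaryForm_smul] at hs0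
      refine Or.inl ⟨s 0 / s 1, (hmem _).mpr (by simpa [h1] using hs0), ?_⟩
      conv_rhs => rw [e, segreLine_smul Ψ h1]
  by_cases h : m 0 0 = 0
  · have hset : {L | ∃ s ≠ 0, binaryForm q m s = 0 ∧ L = segreLine Ψ s} =
        insert (segreLine Ψ ![1, 0]) ((fun x : k => segreLine Ψ ![x, 1]) '' f.rootSet k) := by
      ext L
      constructor
      · rintro ⟨s, hs, hs0, rfl⟩
        rcases hcase s hs hs0 with h' | h'
        exacts [Or.inr h', Or.inl h'.2]
      · rintro (rfl | ⟨x, hx, rfl⟩)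
        exacts [⟨_, hne, hinf.trans h, rfl⟩, ⟨_, hne' x, (hmem x).mp hx, rfl⟩]
    rw [hset, Set.ncard_insert_of_notMem, himg, natDegree_affineForm_of_eq hq2 hm h]
    rintro ⟨x, -, hx⟩
    simpa using cross_eq_zero_of_segreLine_eq Ψ (hne' x) hx
  · rw [← natDegree_affineForm_of_ne (by omega) h, ← hf, ← himg]
    congr
    ext L
    constructor
    · rintro ⟨s, hs, hs0, rfl⟩
      rcases hcase s hs hs0 with h' | h'
      exacts [h', (h h'.1).elim]
    · rintro ⟨x, hx, rfl⟩
      exact ⟨_, hne' x, (hmem x).mp hx, rfl⟩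

theorem exists_binaryForm_ne_zero [IsAlgClosed k] {q : ℕ} (hq : (q : k) = 0)
    {m : Matrix (Fin 2) (Fin 2) k} (hm : m.det ≠ 0) : ∃ s, binaryForm q m s ≠ 0 := by
  by_contra! h
  refine (separable_affineForm hq hm).ne_zero (Polynomial.funext fun x => ?_)
  rw [eval_affineForm, h, Polynomial.eval_zero]

/-- The form whose zeros are the points of the line over the field with `q` elements. -/
theorem binaryForm_symplectic (q : ℕ) (s : Fin 2 → k) :
    binaryForm q !![0, 1; -1, 0] s = s 0 ^ q * s 1 - s 1 ^ q * s 0 := by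
  simp [binaryForm]
  ring

end Counting

/-! ### The configuration cut out by a split form, and its uniqueness. -/

section Configuration

open Matrix

variable {k : Type*} [Field k] (Ψ : Matrix (Fin 2) (Fin 2) k ≃ₗ[k] (Fin 4 → k))

/-- The form `F` of degree `d` splits on the quadric as a product of two nondegenerate binary
Frobenius forms. -/
structure IsSplitForm (q d : ℕ) (F : MvPolynomial (Fin 4) k)
    (m n : Matrix (Fin 2) (Fin 2) k) : Prop where
  homogeneous : F.IsHomogeneous d
  left : m.det ≠ 0
  right : n.det ≠ 0
  eval_segre (s a : Fin 2 → k) : eval (segre Ψ s a) F = binaryForm q m a * binaryForm q n s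

variable {Ψ} {q d : ℕ} {F : MvPolynomial (Fin 4) k} {m n : Matrix (Fin 2) (Fin 2) k}

theorem IsSplitForm.flip (h : IsSplitForm Ψ q d F m n) :
    IsSplitForm (flipRows Ψ) q d F n m :=
  ⟨h.1, h.3, h.2, fun s a => by rw [segre_flipRows, h.4, mul_comm]⟩

theorem IsSplitForm.segreLine_subset (h : IsSplitForm Ψ q d F m n) {s : Fin 2 → k}
    (hs : binaryForm q n s = 0) : (segreLine Ψ s : Set (PThree k)) ⊆ projZeros F := by
  intro P hP
  induction P using Projectivization.ind with
  | h v hv =>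
    obtain ⟨a, rfl⟩ := (mk_mem_segreLine Ψ hv).mp hP
    rw [mk_mem_projZeros h.homogeneous, h.eval_segre, hs, mul_zero]

theorem linesOn_inter_eq_union (Z : Set (PThree k)) :
    linesOn (Z ∩ segreQuadric Ψ) = linesOn (Z ∩ segreQuadric Ψ) ∩ segreRuling Ψ ∪
      linesOn (Z ∩ segreQuadric Ψ) ∩ segreRuling (flipRows Ψ) := by
  rw [← Set.inter_union_distrib_left, eq_comm, Set.inter_eq_left, ← linesOn_segreQuadric]
  exact fun L hL => ⟨hL.1, hL.2.trans Set.inter_subset_right⟩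

theorem Meet.symm {l m : Projectivization.Subspace k (Fin 4 → k)} (h : Meet l m) : Meet m l := by
  rwa [Meet, Set.inter_comm]

theorem IsLine.meet_self {l : Projectivization.Subspace k (Fin 4 → k)} (h : IsLine l) :
    Meet l l := by
  have : l.submodule ≠ ⊥ := by
    intro h0
    rw [IsLine, h0, finrank_bot] at h
    omega
  obtain ⟨v, hv, hv0⟩ := Submodule.exists_mem_ne_zero_of_ne_bot this
  have := (Projectivization.Subspace.mem_submodule_iff l hv0).mp hv
  exact ⟨_, this, this⟩

theorem Skew.ne {l m : Projectivization.Subspace k (Fin 4 → k)} (hl : IsLine l) (h : Skew l m) :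
    l ≠ m := by
  rintro rfl
  exact h hl.meet_self

variable [IsAlgClosed k]

/-- Along the line of `s` the form is a constant multiple of the nonzero form `m`, the constant
being the value of `n` at `s`. -/
theorem IsSplitForm.binaryForm_eq_zero (h : IsSplitForm Ψ q d F m n) (hq : (q : k) = 0)
    {s : Fin 2 → k} (hs : s ≠ 0)
    (hsub : (segreLine Ψ s : Set (PThree k)) ⊆ projZeros F) : binaryForm q n s = 0 := by
  obtain ⟨a, ha⟩ := exists_binaryForm_ne_zero hq h.left
  have ha0 : a ≠ 0 := by
    rintro rfl
    exact ha (by simp [binaryForm])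
  have hz := segre_ne_zero Ψ hs ha0
  have h1 := hsub (mk_segre_mem Ψ hz)
  rw [mk_mem_projZeros h.homogeneous, h.eval_segre] at h1
  exact (mul_eq_zero.mp h1).resolve_left ha

theorem IsSplitForm.linesOn_inter_segreRuling (h : IsSplitForm Ψ q d F m n)
    (hq : (q : k) = 0) :
    linesOn (projZeros F ∩ segreQuadric Ψ) ∩ segreRuling Ψ =
      {L | ∃ s ≠ 0, binaryForm q n s = 0 ∧ L = segreLine Ψ s} := by
  ext L
  constructor
  · rintro ⟨⟨-, hL⟩, s, hs, rfl⟩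
    exact ⟨s, hs, h.binaryForm_eq_zero hq hs (hL.trans Set.inter_subset_left), rfl⟩
  · rintro ⟨s, hs, hs0, rfl⟩
    have hR : segreLine Ψ s ∈ segreRuling Ψ := ⟨s, hs, rfl⟩
    exact ⟨⟨isLine_segreLine Ψ hs, Set.subset_inter (h.segreLine_subset hs0)
      (segreRuling_subset Ψ hR).2⟩, hR⟩

theorem IsSplitForm.ncard_linesOn_inter (h : IsSplitForm Ψ q d F m n) (hq : (q : k) = 0)
    (hq2 : 2 ≤ q) :
    (linesOn (projZeros F ∩ segreQuadric Ψ) ∩ segreRuling Ψ).ncard = q + 1 := by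
  rw [h.linesOn_inter_segreRuling hq, ncard_segreLine_zeros Ψ hq2 hq h.right]

/-- The point `a sᵀ` lies on the line of `s` and on the opposite line of `a`. Whichever factor of
`F` vanishes there puts the corresponding line on the surface. -/
theorem IsSplitForm.inter_eq_iUnion (h : IsSplitForm Ψ q d F m n) (hq : (q : k) = 0) :
    projZeros F ∩ segreQuadric Ψ =
      ⋃ l ∈ linesOn (projZeros F ∩ segreQuadric Ψ), (l : Set (PThree k)) := by
  refine Set.Subset.antisymm ?_ (Set.iUnion₂_subset fun l hl => hl.2)
  rintro P ⟨hPF, hPQ⟩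
  have key {Φ : Matrix (Fin 2) (Fin 2) k ≃ₗ[k] (Fin 4 → k)} {m n}
      (h : IsSplitForm Φ q d F m n) (s) (hs : s ≠ 0) (hP : P ∈ segreLine Φ s)
      (hs0 : binaryForm q n s = 0) :
      P ∈ ⋃ l ∈ linesOn (projZeros F ∩ segreQuadric Φ), (l : Set (PThree k)) := by
    have hl : segreLine Φ s ∈ linesOn (projZeros F ∩ segreQuadric Φ) ∩ segreRuling Φ := by
      rw [h.linesOn_inter_segreRuling hq]
      exact ⟨s, hs, hs0, rfl⟩
    exact Set.mem_biUnion hl.1 hP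
  induction P using Projectivization.ind with
  | h v hv =>
    obtain ⟨s, a, hs, rfl⟩ := exists_eq_segre Ψ ((mk_mem_segreQuadric Ψ hv).mp hPQ)
    rw [mk_mem_projZeros h.homogeneous, h.eval_segre] at hPF
    rcases mul_eq_zero.mp hPF with h0 | h0
    · have ha : a ≠ 0 := by
        rintro rfl
        simp at hv
      rw [← segreQuadric_flipRows]
      exact key h.flip a ha ((mk_mem_segreLine _ hv).mpr ⟨s, segre_flipRows Ψ a s⟩) h0
    · exact key h s hs (mk_segre_mem Ψ hv) h0

theorem IsSplitForm.ncard_linesOn (h : IsSplitForm Ψ q d F m n) (hq : (q : k) = 0)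
    (hq2 : 2 ≤ q) : (linesOn (projZeros F ∩ segreQuadric Ψ)).ncard = 2 * (q + 1) := by
  have h1 := h.ncard_linesOn_inter hq hq2
  have h2 := h.flip.ncard_linesOn_inter hq hq2
  rw [segreQuadric_flipRows] at h2
  rw [linesOn_inter_eq_union, Set.ncard_union_eq
    ((disjoint_segreRuling Ψ).mono Set.inter_subset_right Set.inter_subset_right)
    (Set.finite_of_ncard_ne_zero (by omega)) (Set.finite_of_ncard_ne_zero (by omega)),
    h1, h2, two_mul]

theorem IsSplitForm.isQuadricConfiguration (h : IsSplitForm Ψ q d F m n) (hq : (q : k) = 0)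
    (hq2 : 2 ≤ q) :
    IsQuadricConfiguration (projZeros F) (q + 1) (linesOn (projZeros F ∩ segreQuadric Ψ)) := by
  have h2 := h.flip.ncard_linesOn_inter hq hq2
  rw [segreQuadric_flipRows] at h2
  exact ⟨fun L hL => ⟨hL.1, hL.2.trans Set.inter_subset_left⟩, h.ncard_linesOn hq hq2, _, _,
    linesOn_inter_eq_union _, h.ncard_linesOn_inter hq hq2, h2,
    (pairwise_skew_segreRuling Ψ).mono Set.inter_subset_right,
    (pairwise_skew_segreRuling _).mono Set.inter_subset_right,
    fun l hl m hm => meet_of_mem_segreRuling Ψ hl.2 hm.2⟩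

theorem IsSplitForm.eq_of_isQuadricConfiguration (h : IsSplitForm Ψ q d F m n) (hq : (q : k) = 0)
    (hq2 : 2 ≤ q) {L₁ L₂ L₃ : Projectivization.Subspace k (Fin 4 → k)}
    (hL₁ : L₁ ∈ segreRuling Ψ) (hL₂ : L₂ ∈ segreRuling Ψ) (hL₃ : L₃ ∈ segreRuling Ψ)
    (h₁₂ : Skew L₁ L₂) (h₁₃ : Skew L₁ L₃) (h₂₃ : Skew L₂ L₃)
    {C : Set (Projectivization.Subspace k (Fin 4 → k))}
    (hC : IsQuadricConfiguration (projZeros F) (q + 1) C)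
    (hC₁ : L₁ ∈ C) (hC₂ : L₂ ∈ C) (hC₃ : L₃ ∈ C) :
    C = linesOn (projZeros F ∩ segreQuadric Ψ) := by
  obtain ⟨hCF, -, A, B, rfl, hA, hB, hAs, hBs, hAB⟩ := hC
  wlog h₁A : L₁ ∈ A generalizing A B
  · rw [Set.union_comm] at hCF hC₁ hC₂ hC₃ ⊢
    exact this B A hC₁ hC₂ hC₃ hCF hB hA hBs hAs (fun l hl m hm => (hAB m hm l hl).symm)
      (hC₁.resolve_right h₁A)
  have hline {L} (hL : L ∈ segreRuling Ψ) : IsLine L := (segreRuling_subset Ψ hL).1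
  -- In `B` it would meet `L₁`.
  have h₂A : L₂ ∈ A := hC₂.resolve_right fun h' => h₁₂ (hAB _ h₁A _ h')
  have h₃A : L₃ ∈ A := hC₃.resolve_right fun h' => h₁₃ (hAB _ h₁A _ h')
  have hBR : B ⊆ segreRuling (flipRows Ψ) := fun l hl =>
    mem_segreRuling_flipRows_of_meet Ψ (hCF (Or.inr hl)).1 hL₁ hL₂ hL₃ (h₁₂.ne (hline hL₁))
      (h₁₃.ne (hline hL₁)) (h₂₃.ne (hline hL₂)) (hAB _ h₁A _ hl).symm (hAB _ h₂A _ hl).symm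
      (hAB _ h₃A _ hl).symm
  -- Since `q + 1 ≥ 3`, the set `B` supplies three lines of the opposite ruling, which in turn force
  -- `A` into the first ruling.
  obtain ⟨M₁, hM₁, M₂, hM₂, M₃, hM₃, h12, h13, h23⟩ :
      ∃ M₁ ∈ B, ∃ M₂ ∈ B, ∃ M₃ ∈ B, M₁ ≠ M₂ ∧ M₁ ≠ M₃ ∧ M₂ ≠ M₃ := by
    have := (Set.two_lt_ncard_iff (Set.finite_of_ncard_ne_zero (s := B) (by omega))).mp
      (by omega : 2 < B.ncard)
    obtain ⟨a, b, c, ha, hb, hc, hab⟩ := this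
    exact ⟨a, ha, b, hb, c, hc, hab⟩
  have hAR : A ⊆ segreRuling Ψ := fun l hl => by
    rw [← flipRows_flipRows Ψ]
    exact mem_segreRuling_flipRows_of_meet _ (hCF (Or.inl hl)).1 (hBR hM₁) (hBR hM₂) (hBR hM₃)
      h12 h13 h23 (hAB _ hl _ hM₁) (hAB _ hl _ hM₂) (hAB _ hl _ hM₃)
  have h1 := h.ncard_linesOn_inter hq hq2
  have h2 := h.flip.ncard_linesOn_inter hq hq2
  rw [segreQuadric_flipRows] at h2
  rw [linesOn_inter_eq_union]
  congr 1
  · refine Set.eq_of_subset_of_ncard_le (fun l hl => ⟨⟨(hCF (Or.inl hl)).1, Set.subset_inter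
      (hCF (Or.inl hl)).2 (segreRuling_subset Ψ (hAR hl)).2⟩, hAR hl⟩) (by omega)
      (Set.finite_of_ncard_ne_zero (by omega))
  · refine Set.eq_of_subset_of_ncard_le (fun l hl => ⟨⟨(hCF (Or.inr hl)).1, Set.subset_inter
      (hCF (Or.inr hl)).2 ((isRuling_segreRuling_flipRows Ψ).1 (hBR hl)).2⟩, hBR hl⟩) (by omega)
      (Set.finite_of_ncard_ne_zero (by omega))

end Configuration

/-! ### Coordinates adapted to three skew lines, and the forms vanishing on them. -/

section ThreeLines

open Matrix

variable {k : Type*} [Field k]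

theorem Skew.disjoint {L M : Projectivization.Subspace k (Fin 4 → k)} (h : Skew L M) {v : Fin 4 → k}
    (hL : v ∈ L.submodule) (hM : v ∈ M.submodule) : v = 0 := by
  by_contra hv
  exact h ⟨_, (Projectivization.Subspace.mem_submodule_iff L hv).mp hL,
    (Projectivization.Subspace.mem_submodule_iff M hv).mp hM⟩

theorem eq_segreLine {Ψ : Matrix (Fin 2) (Fin 2) k ≃ₗ[k] (Fin 4 → k)}
    {L : Projectivization.Subspace k (Fin 4 → k)} (hL : IsLine L) {s : Fin 2 → k} (hs : s ≠ 0)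
    (h : ∀ a, segre Ψ s a ∈ L.submodule) : L = segreLine Ψ s := by
  apply Projectivization.Subspace.submodule.injective
  have hl : Module.finrank k (segreLine Ψ s).submodule = 2 := isLine_segreLine Ψ hs
  refine (Submodule.eq_of_le_of_finrank_eq ?_ (hl.trans hL.symm)).symm
  rw [segreLine, Submodule.projectivization, OrderIso.apply_symm_apply]
  rintro _ ⟨a, rfl⟩
  exact h a

/-- Three pairwise skew lines are members of a ruling of a quadric. -/
theorem exists_eq_segreLine {L₁ L₂ L₃ : Projectivization.Subspace k (Fin 4 → k)}
    (hL₁ : IsLine L₁) (hL₂ : IsLine L₂) (hL₃ : IsLine L₃)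
    (h₁₂ : Skew L₁ L₂) (h₁₃ : Skew L₁ L₃) (h₂₃ : Skew L₂ L₃) :
    ∃ Ψ : Matrix (Fin 2) (Fin 2) k ≃ₗ[k] (Fin 4 → k),
      L₁ = segreLine Ψ ![1, 0] ∧ L₂ = segreLine Ψ ![0, 1] ∧ L₃ = segreLine Ψ ![1, 1] := by
  have hsup : L₁.submodule ⊔ L₂.submodule = ⊤ := by
    apply Submodule.eq_top_of_finrank_eq
    have h := Submodule.finrank_sup_add_finrank_inf_eq L₁.submodule L₂.submodule
    have h0 : L₁.submodule ⊓ L₂.submodule = ⊥ :=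
      (Submodule.eq_bot_iff _).mpr fun v hv => h₁₂.disjoint hv.1 hv.2
    rw [h0, finrank_bot, show Module.finrank k L₁.submodule = 2 from hL₁,
      show Module.finrank k L₂.submodule = 2 from hL₂] at h
    simpa using h
  -- `L₃` is the graph of an isomorphism from `L₁` to `L₂`: the components `u`, `v` of a basis of
  -- `L₃` are bases of `L₁` and `L₂`. They serve as the coordinates of the two matrix columns.
  let b := Module.finBasisOfFinrankEq k L₃.submodule hL₃
  have hdec (i : Fin 2) : ∃ u ∈ L₁.submodule, ∃ v ∈ L₂.submodule, u + v = b i :=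
    Submodule.mem_sup.mp (hsup ▸ Submodule.mem_top)
  choose u hu v hv huv using hdec
  have hb (a : Fin 2 → k) (h : a 0 • (b 0 : Fin 4 → k) + a 1 • (b 1 : Fin 4 → k) = 0) : a = 0 := by
    have h' : ∑ i, a i • b i = 0 := by
      rw [Fin.sum_univ_two]
      exact Subtype.ext h
    exact funext (Fintype.linearIndependent_iff.mp b.linearIndependent a h')
  have hu1 (a : Fin 2 → k) : a 0 • u 0 + a 1 • u 1 ∈ L₁.submodule :=
    add_mem (Submodule.smul_mem _ _ (hu 0)) (Submodule.smul_mem _ _ (hu 1))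
  have hv2 (a : Fin 2 → k) : a 0 • v 0 + a 1 • v 1 ∈ L₂.submodule :=
    add_mem (Submodule.smul_mem _ _ (hv 0)) (Submodule.smul_mem _ _ (hv 1))
  have hb3 (a : Fin 2 → k) : a 0 • (b 0 : Fin 4 → k) + a 1 • (b 1 : Fin 4 → k) ∈ L₃.submodule :=
    add_mem (Submodule.smul_mem _ _ (b 0).2) (Submodule.smul_mem _ _ (b 1).2)
  have hsum (a : Fin 2 → k) : a 0 • (b 0 : Fin 4 → k) + a 1 • (b 1 : Fin 4 → k) =
      (a 0 • u 0 + a 1 • u 1) + (a 0 • v 0 + a 1 • v 1) := by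
    rw [← huv, ← huv]
    module
  have hu0 (a : Fin 2 → k) (h : a 0 • u 0 + a 1 • u 1 = 0) : a = 0 := by
    refine hb a (h₂₃.disjoint ?_ (hb3 a))
    rw [hsum, h, zero_add]
    exact hv2 a
  have hv0 (a : Fin 2 → k) (h : a 0 • v 0 + a 1 • v 1 = 0) : a = 0 := by
    refine hb a (h₁₃.disjoint ?_ (hb3 a))
    rw [hsum, h, add_zero]
    exact hu1 a
  let f : Matrix (Fin 2) (Fin 2) k →ₗ[k] (Fin 4 → k) :=
    { toFun := fun A => (A 0 0 • u 0 + A 1 0 • u 1) + (A 0 1 • v 0 + A 1 1 • v 1)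
      map_add' := fun A B => by
        simp only [Matrix.add_apply]
        module
      map_smul' := fun c A => by
        simp only [Matrix.smul_apply, smul_eq_mul, RingHom.id_apply]
        module }
  have hf (A) : f A = (A 0 0 • u 0 + A 1 0 • u 1) + (A 0 1 • v 0 + A 1 1 • v 1) := rfl
  have hinj : Function.Injective f := by
    rw [← LinearMap.ker_eq_bot, LinearMap.ker_eq_bot']
    intro A hA
    rw [hf] at hA
    have hA0 : A 0 0 • u 0 + A 1 0 • u 1 = 0 := by
      refine h₁₂.disjoint (hu1 fun i => A i 0) ?_
      rw [eq_neg_of_add_eq_zero_left hA]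
      exact neg_mem (hv2 fun i => A i 1)
    have hA1 : A 0 1 • v 0 + A 1 1 • v 1 = 0 := by rwa [hA0, zero_add] at hA
    ext i j
    have h0 := congrFun (hu0 (fun i => A i 0) hA0) i
    have h1 := congrFun (hv0 (fun i => A i 1) hA1) i
    fin_cases j
    exacts [h0, h1]
  let Ψ := LinearEquiv.ofInjectiveOfFinrankEq f hinj (by simp [Module.finrank_matrix])
  have hΨ (s a : Fin 2 → k) : segre Ψ s a =
      s 0 • (a 0 • u 0 + a 1 • u 1) + s 1 • (a 0 • v 0 + a 1 • v 1) := by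
    rw [segre_apply]
    change f _ = _
    rw [hf]
    simp only [vecMulVec_apply]
    module
  refine ⟨Ψ, eq_segreLine hL₁ (by simp) fun a => ?_, eq_segreLine hL₂ (by simp) fun a => ?_,
    eq_segreLine hL₃ (by simp) fun a => ?_⟩
  · simpa [hΨ] using hu1 a
  · simpa [hΨ] using hv2 a
  · have := hb3 a
    rw [hsum] at this
    simpa [hΨ] using this

variable (Ψ : Matrix (Fin 2) (Fin 2) k ≃ₗ[k] (Fin 4 → k))

theorem segre_eq_smul_add (s a : Fin 2 → k) :
    segre Ψ s a = s 0 • segre Ψ ![1, 0] a + s 1 • segre Ψ ![0, 1] a := by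
  simp only [segre_apply, ← map_smul, ← map_add]
  congr 1
  ext i j
  fin_cases j <;> simp [vecMulVec_apply, mul_comm]

theorem segre_eq_sum (s a : Fin 2 → k) :
    segre Ψ s a = a 0 • segre Ψ s ![1, 0] + a 1 • segre Ψ s ![0, 1] := by
  rw [← map_smul, ← map_smul, ← map_add]
  congr 1
  ext j
  fin_cases j <;> simp

theorem apply_eq_segre_add (A : Matrix (Fin 2) (Fin 2) k) :
    Ψ A = segre Ψ ![1, 0] (fun i => A i 0) + segre Ψ ![0, 1] (fun i => A i 1) := by
  rw [segre_apply, segre_apply, ← map_add]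
  congr 1
  ext i j
  fin_cases j <;> simp

theorem eval_eq_zero_of_subset {F : MvPolynomial (Fin 4) k} {d : ℕ} (hF : F.IsHomogeneous d)
    (hd : d ≠ 0) {L : Projectivization.Subspace k (Fin 4 → k)}
    (hL : (L : Set (PThree k)) ⊆ projZeros F) {v : Fin 4 → k} (hv : v ∈ L.submodule) :
    eval v F = 0 := by
  by_cases h0 : v = 0
  · rw [h0, eval_zero, constantCoeff_eq]
    exact hF.coeff_eq_zero (by simpa using hd.symm)
  · exact (mk_mem_projZeros hF v h0).mp
      (hL ((Projectivization.Subspace.mem_submodule_iff L h0).mp hv))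

theorem segre_mem_segreLine (s a : Fin 2 → k) : segre Ψ s a ∈ (segreLine Ψ s).submodule := by
  rw [segreLine, Submodule.projectivization, OrderIso.apply_symm_apply]
  exact ⟨a, rfl⟩

/-- A smooth Frobenius form that vanishes on three lines of a ruling of a quadric is split on
this quadric. -/
theorem exists_isSplitForm [IsAlgClosed k] {q : ℕ} (hq2 : 2 ≤ q) (hq : (q : k) = 0) {τ : k →+* k}
    (hτ : ∀ x, τ x = x ^ q) {F : MvPolynomial (Fin 4) k} (hF : IsFrobeniusForm q F)
    (hsmooth : IsSmoothForm F)
    (h₁ : (segreLine Ψ ![1, 0] : Set (PThree k)) ⊆ projZeros F)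
    (h₂ : (segreLine Ψ ![0, 1] : Set (PThree k)) ⊆ projZeros F)
    (h₃ : (segreLine Ψ ![1, 1] : Set (PThree k)) ⊆ projZeros F) :
    ∃ m n, IsSplitForm Ψ q (q + 1) F m n := by
  obtain ⟨B, hB, hdB⟩ := hF.exists_sesqForm hq τ hτ
  have hz {s} (h : (segreLine Ψ s : Set (PThree k)) ⊆ projZeros F) (a b : Fin 2 → k) :
      B (segre Ψ s a) (segre Ψ s b) = 0 :=
    sesq_eq_zero_of_diag_eq_zero hq2 hτ B _ (fun v hv => by
      rw [← hB, eval_eq_zero_of_subset hF.1 (by omega) h hv])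
      (segre_mem_segreLine Ψ s a) (segre_mem_segreLine Ψ s b)
  -- Vanishing on the diagonal line `s = (1,1)` makes the two mixed terms opposite; this produces
  -- the factor `s₀^q s₁ - s₁^q s₀`.
  have hanti (a b : Fin 2 → k) : B (segre Ψ ![0, 1] a) (segre Ψ ![1, 0] b) =
      -B (segre Ψ ![1, 0] a) (segre Ψ ![0, 1] b) := by
    have := hz h₃ a b
    rw [segre_eq_smul_add Ψ ![1, 1] a, segre_eq_smul_add Ψ ![1, 1] b] at this
    simp only [cons_val_zero, cons_val_one, one_smul, map_add, LinearMap.add_apply, hz h₁, hz h₂,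
      zero_add, add_zero] at this
    linear_combination this
  let m : Matrix (Fin 2) (Fin 2) k := fun i j =>
    B (segre Ψ ![1, 0] (Pi.single i 1)) (segre Ψ ![0, 1] (Pi.single j 1))
  have hsingle (a : Fin 2 → k) : a = a 0 • Pi.single 0 1 + a 1 • Pi.single 1 1 := by
    ext j
    fin_cases j <;> simp
  have hm (a b : Fin 2 → k) : B (segre Ψ ![1, 0] a) (segre Ψ ![0, 1] b) =
      ∑ j, (∑ i, a i ^ q * m i j) * b j := by
    conv_lhs => rw [hsingle a, hsingle b]
    simp only [map_add, LinearMap.add_apply, LinearMap.map_smulₛₗ, LinearMap.smul_apply,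
      RingHom.id_apply, smul_eq_mul, hτ, Fin.sum_univ_two, m]
    ring
  refine ⟨m, !![0, 1; -1, 0], hF.1, fun hdet => ?_, by simp [det_fin_two], fun s a => ?_⟩
  -- If `m` is singular, `q`-th roots of the entries of a left kernel vector give a point of the
  -- first line at which `B` kills every second argument. All partial derivatives vanish there,
  -- against smoothness.
  · obtain ⟨c, hc, hcm⟩ := exists_vecMul_eq_zero_iff.mpr hdet
    choose a ha using fun i => IsAlgClosed.exists_pow_nat_eq (c i) (n := q) (by omega)
    have ha0 : a ≠ 0 := by
      rintro rfl
      refine hc (funext fun i => ?_)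
      rw [← ha, Pi.zero_apply, zero_pow (by omega)]
    have hB1 (b : Fin 2 → k) : B (segre Ψ ![1, 0] a) (segre Ψ ![0, 1] b) = 0 := by
      rw [hm]
      refine Finset.sum_eq_zero fun j _ => ?_
      have := congrFun hcm j
      simp only [vecMul, dotProduct, Pi.zero_apply] at this
      simp only [ha, this, zero_mul]
    have hB0 (w : Fin 4 → k) : B (segre Ψ ![1, 0] a) w = 0 := by
      obtain ⟨A, rfl⟩ := Ψ.surjective w
      rw [apply_eq_segre_add, map_add, hz h₁, hB1, add_zero]
    obtain ⟨j, hj⟩ := hsmooth _ (segre_ne_zero Ψ (s := ![1, 0]) (by simp) ha0)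
      (by rw [hB, hB0])
    exact hj (by rw [hdB, hB0])
  · rw [hB, segre_eq_smul_add, binaryForm_symplectic]
    simp only [map_add, LinearMap.add_apply, LinearMap.map_smulₛₗ, LinearMap.smul_apply,
      RingHom.id_apply, smul_eq_mul, hτ, hz h₁, hz h₂, hanti, hm, binaryForm, Fin.sum_univ_two]
    ring

/-- The quadratic form whose zeros are the matrices of determinant zero. -/
noncomputable def detForm : MvPolynomial (Fin 4) k :=
  let l (i j : Fin 2) : MvPolynomial (Fin 4) k := ∑ t, C (Ψ.symm (Pi.single t 1) i j) * X t
  l 0 0 * l 1 1 - l 0 1 * l 1 0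

theorem isHomogeneous_detForm : (detForm Ψ).IsHomogeneous 2 := by
  have h (i j : Fin 2) : (∑ t, C (Ψ.symm (Pi.single t 1) i j) * X t :
      MvPolynomial (Fin 4) k).IsHomogeneous 1 :=
    IsHomogeneous.sum _ _ _ fun t _ => isHomogeneous_C_mul_X _ _
  exact ((h 0 0).mul (h 1 1)).sub ((h 0 1).mul (h 1 0))

theorem eval_linearForm (v : Fin 4 → k) (i j : Fin 2) :
    eval v (∑ t, C (Ψ.symm (Pi.single t 1) i j) * X t) = Ψ.symm v i j := by
  conv_rhs => rw [pi_eq_sum_univ' v]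
  simp only [map_sum, map_mul, eval_C, eval_X, map_smul, Matrix.sum_apply, Matrix.smul_apply,
    smul_eq_mul, mul_comm]

theorem eval_detForm (v : Fin 4 → k) : eval v (detForm Ψ) = (Ψ.symm v).det := by
  simp only [detForm, map_sub, map_mul (eval v), eval_linearForm, det_fin_two]

theorem eval_pderiv_detForm (v : Fin 4 → k) (t : Fin 4) :
    let D := Ψ.symm (Pi.single t 1)
    let A := Ψ.symm v
    eval v (pderiv t (detForm Ψ)) = D 0 0 * A 1 1 + A 0 0 * D 1 1 - D 0 1 * A 1 0 - A 0 1 * D 1 0 := by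
  have h (i j : Fin 2) : pderiv t (∑ t, C (Ψ.symm (Pi.single t 1) i j) * X t :
      MvPolynomial (Fin 4) k) = C (Ψ.symm (Pi.single t 1) i j) := by
    simp [pderiv_X, Pi.single_apply]
  simp only [detForm, map_sub, Derivation.leibniz, h, smul_eq_mul, map_add, map_mul (eval v),
    eval_linearForm, eval_C]
  ring

/-- The partial derivatives at `v` assemble into the polar form of the determinant, which is
nondegenerate in every characteristic: pairing with matrix units recovers each entry up to sign. -/
theorem isSmoothForm_detForm : IsSmoothForm (detForm Ψ) := by
  intro v hv _
  by_contra! h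
  set A := Ψ.symm v with hA
  let f : (Fin 4 → k) →ₗ[k] k :=
    { toFun := fun w => Ψ.symm w 0 0 * A 1 1 + A 0 0 * Ψ.symm w 1 1 - Ψ.symm w 0 1 * A 1 0
        - A 0 1 * Ψ.symm w 1 0
      map_add' := fun x y => by
        simp only [map_add, Matrix.add_apply]
        ring
      map_smul' := fun c x => by
        simp only [map_smul, Matrix.smul_apply, smul_eq_mul, RingHom.id_apply]
        ring }
  have hf : f = 0 := by
    refine LinearMap.pi_ext' fun t => LinearMap.ext_ring ?_
    have ht := h t
    rw [eval_pderiv_detForm] at ht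
    exact ht
  have key (D : Matrix (Fin 2) (Fin 2) k) :
      D 0 0 * A 1 1 + A 0 0 * D 1 1 - D 0 1 * A 1 0 - A 0 1 * D 1 0 = 0 := by
    have := LinearMap.congr_fun hf (Ψ D)
    simpa [f] using this
  apply hv
  rw [← map_eq_zero_iff _ Ψ.symm.injective, ← hA]
  ext i j
  fin_cases i <;> fin_cases j
  · simpa using key !![0, 0; 0, 1]
  · simpa using key !![0, 0; 1, 0]
  · simpa using key !![0, 1; 0, 0]
  · simpa using key !![1, 0; 0, 0]

theorem isSmoothQuadric_segreQuadric : IsSmoothQuadric (segreQuadric Ψ) := by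
  refine ⟨detForm Ψ, isHomogeneous_detForm Ψ, isSmoothForm_detForm Ψ, ?_⟩
  ext P
  simp [segreQuadric, projZeros, eval_detForm]

/-- The smooth quadric through three lines of a ruling is the quadric of the ruling. -/
theorem eq_segreQuadric [Infinite k] {Q : Set (PThree k)} (hQ : IsSmoothQuadric Q)
    (h₁ : (segreLine Ψ ![1, 0] : Set (PThree k)) ⊆ Q)
    (h₂ : (segreLine Ψ ![0, 1] : Set (PThree k)) ⊆ Q)
    (h₃ : (segreLine Ψ ![1, 1] : Set (PThree k)) ⊆ Q) : Q = segreQuadric Ψ := by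
  obtain ⟨G, hG, hsmooth, rfl⟩ := hQ
  obtain ⟨B, hB⟩ := hG.exists_bilinForm
  have hz {s} (h : (segreLine Ψ s : Set (PThree k)) ⊆ projZeros G) (a : Fin 2 → k) :
      B (segre Ψ s a) (segre Ψ s a) = 0 := by
    rw [← hB, eval_eq_zero_of_subset hG (by omega) h (segre_mem_segreLine Ψ s a)]
  -- `B` need not be symmetric, so both mixed terms are kept. The third line makes `γ` alternating,
  -- hence a multiple of the 2 × 2 determinant, also in characteristic 2.
  let γ (a b : Fin 2 → k) : k := B (segre Ψ ![1, 0] a) (segre Ψ ![0, 1] b) +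
    B (segre Ψ ![0, 1] b) (segre Ψ ![1, 0] a)
  have hγ (a : Fin 2 → k) : γ a a = 0 := by
    have := hz h₃ a
    rw [segre_eq_smul_add] at this
    simp only [cons_val_zero, cons_val_one, one_smul, map_add, LinearMap.add_apply, hz h₁, hz h₂,
      zero_add, add_zero] at this
    linear_combination this
  have hγ2 (a b : Fin 2 → k) : γ a b = (a 0 * b 1 - a 1 * b 0) * γ ![1, 0] ![0, 1] := by
    have e0 := hγ ![1, 0]
    have e1 := hγ ![0, 1]
    have e2 := hγ ![1, 1]
    simp only [γ] at e0 e1 e2 ⊢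
    rw [segre_eq_sum Ψ ![1, 0] ![1, 1], segre_eq_sum Ψ ![0, 1] ![1, 1]] at e2
    rw [segre_eq_sum Ψ ![1, 0] a, segre_eq_sum Ψ ![0, 1] b]
    simp only [cons_val_zero, cons_val_one, one_smul, map_add, LinearMap.add_apply, map_smul,
      LinearMap.smul_apply, smul_eq_mul] at e2 ⊢
    linear_combination (a 0 * b 0 - a 1 * b 0) * e0 + (a 1 * b 1 - a 1 * b 0) * e1 + a 1 * b 0 * e2
  have heval (v : Fin 4 → k) : eval v G = (Ψ.symm v).det * γ ![1, 0] ![0, 1] := by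
    obtain ⟨A, rfl⟩ := Ψ.surjective v
    have h := hγ2 (fun i => A i 0) (fun i => A i 1)
    simp only [γ] at h ⊢
    rw [LinearEquiv.symm_apply_apply, det_fin_two, hB, apply_eq_segre_add]
    simp only [map_add, LinearMap.add_apply, hz h₁, hz h₂]
    linear_combination h
  have hne : γ ![1, 0] ![0, 1] ≠ 0 := by
    intro h0
    have hG0 : G = 0 := MvPolynomial.funext fun v => by rw [heval, h0, mul_zero, map_zero]
    obtain ⟨i, hi⟩ := hsmooth (Pi.single 0 1) (by simp) (by rw [heval, h0, mul_zero])
    simp [hG0] at hi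
  ext P
  simp [projZeros, segreQuadric, heval, hne]

end ThreeLines

/-! ### The main theorem. -/

theorem mainTheorem6 {k : Type*} [Field k] [IsAlgClosed k] (p : ℕ) [Fact p.Prime] [CharP k p]
    (e : ℕ) (he : 0 < e) (q : ℕ) (hq : q = p ^ e)
    (F : MvPolynomial (Fin 4) k) (hF : IsFrobeniusForm q F) (hsmooth : IsSmoothForm F)
    (L₁ L₂ L₃ : Projectivization.Subspace k (Fin 4 → k))
    (hL₁ : L₁ ∈ linesOn (projZeros F)) (hL₂ : L₂ ∈ linesOn (projZeros F))
    (hL₃ : L₃ ∈ linesOn (projZeros F))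
    (h₁₂ : Skew L₁ L₂) (h₁₃ : Skew L₁ L₃) (h₂₃ : Skew L₂ L₃) :
    -- there is a unique quadric configuration on the surface containing the three lines
    (∃! C : Set (Projectivization.Subspace k (Fin 4 → k)),
      IsQuadricConfiguration (projZeros F) (q + 1) C ∧ L₁ ∈ C ∧ L₂ ∈ C ∧ L₃ ∈ C) ∧
    -- there is a unique smooth quadric containing the three lines
    (∃! Q : Set (PThree k),
      IsSmoothQuadric Q ∧ L₁ ∈ linesOn Q ∧ L₂ ∈ linesOn Q ∧ L₃ ∈ linesOn Q) ∧
    -- its intersection with the surface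
    ∀ Q : Set (PThree k),
      IsSmoothQuadric Q → L₁ ∈ linesOn Q → L₂ ∈ linesOn Q → L₃ ∈ linesOn Q →
      ∃ C R S : Set (Projectivization.Subspace k (Fin 4 → k)),
        -- `C` is the quadric configuration, and it is the set of lines on the intersection
        IsQuadricConfiguration (projZeros F) (q + 1) C ∧ L₁ ∈ C ∧ L₂ ∈ C ∧ L₃ ∈ C ∧
        C = linesOn (projZeros F ∩ Q) ∧ C.ncard = 2 * (q + 1) ∧
        -- the intersection is the union of the lines in `C`
        projZeros F ∩ Q = ⋃ l ∈ C, (l : Set (PThree k)) ∧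
        -- `R` and `S` are the two rulings of `Q`
        R ≠ S ∧ {T | IsRuling Q T} = {R, S} ∧
        C = (C ∩ R) ∪ (C ∩ S) ∧ (C ∩ R).ncard = q + 1 ∧ (C ∩ S).ncard = q + 1 ∧
        -- each line of one ruling meets every line of the other
        ∀ l ∈ R, ∀ m ∈ S, Meet l m := by
  have hp : p.Prime := Fact.out
  have hq2 : 2 ≤ q := hq ▸ hp.two_le.trans (Nat.le_self_pow he.ne' p)
  have hq0 : (q : k) = 0 := by
    rw [hq, Nat.cast_pow, CharP.cast_eq_zero, zero_pow he.ne']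
  have hτ (x : k) : iterateFrobenius k p e x = x ^ q := by rw [iterateFrobenius_def, hq]
  have : Infinite k := IsAlgClosed.instInfinite
  obtain ⟨Ψ, e₁, e₂, e₃⟩ := exists_eq_segreLine hL₁.1 hL₂.1 hL₃.1 h₁₂ h₁₃ h₂₃
  obtain ⟨m, n, h⟩ := exists_isSplitForm Ψ hq2 hq0 hτ hF hsmooth (e₁ ▸ hL₁.2) (e₂ ▸ hL₂.2)
    (e₃ ▸ hL₃.2)
  have hR₁ : L₁ ∈ segreRuling Ψ := ⟨_, by simp, e₁⟩
  have hR₂ : L₂ ∈ segreRuling Ψ := ⟨_, by simp, e₂⟩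
  have hR₃ : L₃ ∈ segreRuling Ψ := ⟨_, by simp, e₃⟩
  have hmem {L} (hL : L ∈ linesOn (projZeros F)) (hR : L ∈ segreRuling Ψ) :
      L ∈ linesOn (projZeros F ∩ segreQuadric Ψ) :=
    ⟨hL.1, Set.subset_inter hL.2 (segreRuling_subset Ψ hR).2⟩
  have huniq (Q : Set (PThree k)) (hQ : IsSmoothQuadric Q) (hQ₁ : L₁ ∈ linesOn Q)
      (hQ₂ : L₂ ∈ linesOn Q) (hQ₃ : L₃ ∈ linesOn Q) : Q = segreQuadric Ψ :=
    eq_segreQuadric Ψ hQ (e₁ ▸ hQ₁.2) (e₂ ▸ hQ₂.2) (e₃ ▸ hQ₃.2)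
  refine ⟨⟨linesOn (projZeros F ∩ segreQuadric Ψ), ⟨h.isQuadricConfiguration hq0 hq2,
      hmem hL₁ hR₁, hmem hL₂ hR₂, hmem hL₃ hR₃⟩, ?_⟩,
    ⟨segreQuadric Ψ, ⟨isSmoothQuadric_segreQuadric Ψ, segreRuling_subset Ψ hR₁,
      segreRuling_subset Ψ hR₂, segreRuling_subset Ψ hR₃⟩, ?_⟩, ?_⟩
  · rintro C ⟨hC, hC₁, hC₂, hC₃⟩
    exact h.eq_of_isQuadricConfiguration hq0 hq2 hR₁ hR₂ hR₃ h₁₂ h₁₃ h₂₃ hC hC₁ hC₂ hC₃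
  · rintro Q ⟨hQ, hQ₁, hQ₂, hQ₃⟩
    exact huniq Q hQ hQ₁ hQ₂ hQ₃
  · intro Q hQ hQ₁ hQ₂ hQ₃
    obtain rfl := huniq Q hQ hQ₁ hQ₂ hQ₃
    have h2 := h.flip.ncard_linesOn_inter hq0 hq2
    rw [segreQuadric_flipRows] at h2
    refine ⟨_, segreRuling Ψ, segreRuling (flipRows Ψ), h.isQuadricConfiguration hq0 hq2,
      hmem hL₁ hR₁, hmem hL₂ hR₂, hmem hL₃ hR₃, rfl, h.ncard_linesOn hq0 hq2,
      h.inter_eq_iUnion hq0, ?_, Set.ext (isRuling_segreQuadric_iff Ψ),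
      linesOn_inter_eq_union _, h.ncard_linesOn_inter hq0 hq2, h2,
      fun l hl m hm => meet_of_mem_segreRuling Ψ hl hm⟩
    exact fun hRS => (disjoint_segreRuling Ψ).ne_of_mem hR₁ (hRS ▸ hR₁) rfl
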